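/- Let $\mathbb F$ be any field and $d$ any dimension. An element $g\in GL(d,\mathbb F)$ is called unipotent if some positive power of $g-I$ is the zero matrix (equivalently, all its eigenvalues over the algebraic closure of $\mathbb F$ are equal to $1$). A subgroup of $GL(d,\mathbb F)$ is called VUF-linear (virtually unipotent free) if it has a finite index subgroup in which the only unipotent element is the identity. Suppose that the solvable subgroup $S\le GL(d,\mathbb F)$ is VUF-linear. Then $S$ is virtually abelian, that is, $S$ has an abelian subgroup of finite index. If moreover $S$ is a subgroup of some finitely generated group $G\le GL(d,\mathbb F)$ (with the same $d$ and $\mathbb F$), then $S$ is also finitely generated. -/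

import Mathlib

open scoped MatrixGroups

/-- An invertible matrix `g` is unipotent if some power of `g - I` is the zero matrix
(equivalently, all its eigenvalues over the algebraic closure are equal to `1`). -/
def Matrix.GeneralLinearGroup.IsUnipotent {d : ℕ} {F : Type*} [Field F]
    (g : GL (Fin d) F) : Prop :=
  IsNilpotent ((g : Matrix (Fin d) (Fin d) F) - 1)

/-- A subgroup `G` of `GL(d, F)` is VUF-linear (virtually unipotent free) if it has a finite
index subgroup whose only unipotent element is the identity. -/
def IsVUFLinear {d : ℕ} {F : Type*} [Field F] (G : Subgroup (GL (Fin d) F)) : Prop :=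
  ∃ H : Subgroup G, H.FiniteIndex ∧
    ∀ g ∈ H, Matrix.GeneralLinearGroup.IsUnipotent (g : GL (Fin d) F) → g = 1

/-- A group is virtually abelian if it has an abelian subgroup of finite index. -/
def IsVirtuallyAbelian (G : Type*) [Group G] : Prop :=
  ∃ A : Subgroup G, A.FiniteIndex ∧ ∀ a ∈ A, ∀ b ∈ A, a * b = b * a

/-! Pass to a unipotent-free finite-index subgroup and extend scalars to the algebraic closure. An
element of a commutative subgroup `M` is then determined by the values of the finitely many
characters of `M` on joint eigenvectors. If `M` is normal, conjugation acts on these characters, so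
the centralizer of `M` has finite index. If `M` is central and lies in the commutator subgroup, the
values are roots of unity of bounded order, so `M` is finite. These two facts carry virtual
abelianness up the derived series.

For finite generation only a commutative `A` inside a finitely generated `G` matters. The entries of
`G` lie in a finitely generated ring, so `A` maps to finitely many residue fields of a commutative
matrix algebra over a suitable subfield `k`, and the joint kernel is unipotent, hence trivial. The
images are units which, with their inverses, are integral over a finitely generated subring. Such
units form a finitely generated group: for number fields by Dirichlet's unit theorem and finitely
many valuations, then by adjoining one generator of the field at a time. -/

open Module

open scoped commutatorElement

/-! ### Finite-index subgroups. -/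

section FiniteIndex

theorem Subgroup.finiteIndex_of_map_to_finite {G α : Type*} [Group G] [Finite α] (H : Subgroup G)
    (f : G → α) (hf : ∀ g g', f g = f g' → g⁻¹ * g' ∈ H) : H.FiniteIndex := by
  have : Finite (G ⧸ H) := by
    refine Finite.of_injective (fun q : G ⧸ H => f q.out) fun q q' h => ?_
    rw [← q.out_eq', ← q'.out_eq']
    exact QuotientGroup.eq.2 (hf _ _ h)
  exact Subgroup.finiteIndex_of_finite_quotient

theorem IsVirtuallyAbelian.of_finiteIndex {G : Type*} [Group G] (H : Subgroup G)
    [hH : H.FiniteIndex] (h : IsVirtuallyAbelian H) : IsVirtuallyAbelian G := by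
  obtain ⟨A, hA, hcomm⟩ := h
  refine ⟨A.map H.subtype, ⟨?_⟩, ?_⟩
  · rw [Subgroup.index_map_subtype]
    exact mul_ne_zero hA.index_ne_zero hH.index_ne_zero
  · rintro _ ⟨a, ha, rfl⟩ _ ⟨b, hb, rfl⟩
    simpa using congrArg Subtype.val (hcomm a ha b hb)

theorem IsVirtuallyAbelian.of_mulEquiv {G G' : Type*} [Group G] [Group G'] (e : G ≃* G')
    (h : IsVirtuallyAbelian G) : IsVirtuallyAbelian G' := by
  obtain ⟨A, hA, hcomm⟩ := h
  refine ⟨A.map e.toMonoidHom, ⟨?_⟩, ?_⟩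
  · have := A.index_map_equiv e
    rw [show A.map e.toMonoidHom = A.map (e : G →* G') from rfl, this]
    exact hA.index_ne_zero
  · rintro _ ⟨a, ha, rfl⟩ _ ⟨b, hb, rfl⟩
    simpa using congrArg e (hcomm a ha b hb)

end FiniteIndex

/-! ### Joint eigenvectors and their characters. -/

section Joint

variable {K V G : Type*} [Field K] [AddCommGroup V] [Module K V] [Group G]

/-- A representation is unipotent-free if only the identity acts unipotently. -/
def IsUnipotentFree (ρ : G →* End K V) : Prop := ∀ g, IsNilpotent (ρ g - 1) → g = 1

theorem IsUnipotentFree.injective {ρ : G →* End K V} (h : IsUnipotentFree ρ) :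
    Function.Injective ρ := by
  refine (injective_iff_map_eq_one ρ).2 fun g hg => h g ?_
  rw [hg, sub_self]
  exact IsNilpotent.zero

variable [FiniteDimensional K V]

/-- The span of `ρ '' X` is finite-dimensional, so commuting with finitely many elements of `X`
forces commuting with all of them. -/
theorem Subgroup.finiteIndex_centralizer_of_faithful (ρ : G →* End K V)
    (hρ : Function.Injective ρ) (X : Set G)
    (hX : ∀ x ∈ X, (Subgroup.centralizer {x}).FiniteIndex) :
    (Subgroup.centralizer X).FiniteIndex := by
  classical
  have hfg : (Submodule.span K (ρ '' X)).FG := IsNoetherian.noetherian _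
  obtain ⟨T, hTX, hT⟩ := (Submodule.fg_span_iff_fg_span_finset_subset _).1 hfg
  obtain ⟨S, hSX, rfl⟩ := Finset.subset_set_image_iff.1 hTX
  have hfin : (⨅ s ∈ S, Subgroup.centralizer {s} : Subgroup G).FiniteIndex :=
    Subgroup.finiteIndex_iInf' _ fun s hs => hX s (hSX hs)
  refine @Subgroup.finiteIndex_of_le _ _ _ _ hfin fun g hg => ?_
  rw [Subgroup.mem_centralizer_iff]
  intro x hx
  have hmem : ρ x ∈ Submodule.span K ((S.image ρ : Finset (End K V)) : Set (End K V)) :=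
    hT ▸ Submodule.subset_span ⟨x, hx, rfl⟩
  apply hρ
  rw [map_mul, map_mul]
  refine Submodule.span_induction (p := fun y _ => y * ρ g = ρ g * y) ?_ (by simp) ?_ ?_ hmem
  · intro y hy
    obtain ⟨s, hs, rfl⟩ := Finset.mem_image.1 (Finset.mem_coe.1 hy)
    simp only [Subgroup.mem_iInf] at hg
    rw [← map_mul, ← map_mul, Subgroup.mem_centralizer_iff.1 (hg s hs) s rfl]
  · intro a b _ _ ha hb
    rw [add_mul, mul_add, ha, hb]
  · intro c a _ ha
    rw [smul_mul_assoc, mul_smul_comm, ha]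

theorem Module.End.exists_joint_eigenvector [IsAlgClosed K] (F : Set (End K V))
    (hF : ∀ f ∈ F, ∀ g ∈ F, Commute f g) (W : Submodule K V) (hW : W ≠ ⊥)
    (hWF : ∀ f ∈ F, ∀ w ∈ W, f w ∈ W) :
    ∃ v ∈ W, v ≠ 0 ∧ ∀ f ∈ F, ∃ c : K, f v = c • v := by
  induction W using WellFoundedLT.induction with
  | ind W ih =>
    by_cases h : ∃ f ∈ F, ∀ c : K, ∃ w ∈ W, f w ≠ c • w
    · obtain ⟨f, hf, hc⟩ := h
      have : Nontrivial W := Submodule.nontrivial_iff_ne_bot.2 hW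
      obtain ⟨c, hcW⟩ := Module.End.exists_eigenvalue (f.restrict (hWF f hf))
      obtain ⟨w, hw⟩ := hcW.exists_hasEigenvector
      obtain ⟨u, huW, hu⟩ := hc c
      obtain ⟨v, hv, hv0, hvF⟩ := ih (W ⊓ Module.End.eigenspace f c)
        (lt_of_le_of_ne inf_le_left fun h => hu <|
          Module.End.mem_eigenspace_iff.1 ((inf_eq_left.1 h) huW))
        (by
          refine (Submodule.ne_bot_iff _).2 ⟨w, ⟨w.2, Module.End.mem_eigenspace_iff.2 ?_⟩, ?_⟩
          · simpa using congrArg Subtype.val hw.apply_eq_smul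
          · simpa using hw.2)
        (by
          rintro g hg x ⟨hxW, hx⟩
          refine ⟨hWF g hg x hxW, Module.End.mem_eigenspace_iff.2 ?_⟩
          have := LinearMap.congr_fun (hF f hf g hg).eq x
          simp only [Module.End.mul_apply] at this
          rw [this, Module.End.mem_eigenspace_iff.1 hx, map_smul])
      exact ⟨v, hv.1, hv0, hvF⟩
    · push Not at h
      obtain ⟨v, hv, hv0⟩ := (Submodule.ne_bot_iff _).1 hW
      exact ⟨v, hv, hv0, fun f hf => (h f hf).imp fun c hc => hc v hv⟩

theorem Module.End.isNilpotent_of_forall_hasEigenvalue [IsAlgClosed K] (f : End K V)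
    (h : ∀ c, f.HasEigenvalue c → c = 0) : IsNilpotent f := by
  have h0 : Module.End.maxGenEigenspace f 0 = ⊤ := by
    rw [← Module.End.iSup_maxGenEigenspace_eq_top f]
    refine le_antisymm (le_iSup (fun c => Module.End.maxGenEigenspace f c) 0) (iSup_le fun c => ?_)
    by_cases hc : c = 0
    · rw [hc]
    · have : ¬ f.HasEigenvalue c := fun H => hc (h c H)
      have hbot : Module.End.eigenspace f c = ⊥ := by
        by_contra hne
        exact this hne
      have : Module.End.maxGenEigenspace f c = ⊥ := by
        by_contra hne
        obtain ⟨k, hk⟩ : ∃ k, Module.End.genEigenspace f c (k : ℕ) ≠ ⊥ :=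
          ⟨_, by rwa [Module.End.maxGenEigenspace_eq] at hne⟩
        exact this (Module.End.hasEigenvalue_of_hasGenEigenvalue (k := k) hk)
      rw [this]
      exact bot_le
  rw [Module.End.maxGenEigenspace_eq, Module.End.genEigenspace_nat, LinearMap.ker_eq_top] at h0
  exact ⟨_, by simpa using h0⟩

/-- The characters by which a subgroup acts on its joint eigenvectors. -/
def jointCharacters (ρ : G →* End K V) (M : Subgroup G) : Set (M →* K) :=
  {χ | ∃ v : V, v ≠ 0 ∧ ∀ m : M, ρ m v = χ m • v}

/-- Each such character is a matrix coefficient, hence lies in a finite-dimensional space of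
functions, where Dedekind's independence of characters bounds their number. -/
theorem finite_jointCharacters (ρ : G →* End K V) (M : Subgroup G) :
    (jointCharacters ρ M).Finite := by
  let Φ : Dual K (End K V) →ₗ[K] (M → K) :=
    { toFun := fun l m => l (ρ m)
      map_add' := fun _ _ => rfl
      map_smul' := fun _ _ => rfl }
  have hmem : ∀ χ : jointCharacters ρ M, ((χ : M →* K) : M → K) ∈ LinearMap.range Φ := by
    rintro ⟨χ, v, hv, hχ⟩
    obtain ⟨l, hl⟩ := Module.Projective.exists_dual_eq_one K hv
    refine ⟨l ∘ₗ LinearMap.applyₗ v, ?_⟩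
    funext m
    simp [Φ, hχ, hl]
  have hli : LinearIndependent K
      (fun χ : jointCharacters ρ M => (⟨_, hmem χ⟩ : LinearMap.range Φ)) :=
    LinearIndependent.of_comp (LinearMap.range Φ).subtype
      ((linearIndependent_monoidHom M K).comp _ Subtype.val_injective)
  exact hli.finite

theorem exists_mem_jointCharacters [IsAlgClosed K] (ρ : G →* End K V) (M : Subgroup G)
    (hM : ∀ a ∈ M, ∀ b ∈ M, a * b = b * a) (m : M) (c : K) (hc : (ρ m).HasEigenvalue c) :
    ∃ χ ∈ jointCharacters ρ M, χ m = c := by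
  obtain ⟨v, hv, hv0, hvF⟩ := Module.End.exists_joint_eigenvector (ρ '' M)
    (by
      rintro _ ⟨a, ha, rfl⟩ _ ⟨b, hb, rfl⟩
      rw [Commute, SemiconjBy, ← map_mul, ← map_mul, hM a ha b hb])
    (Module.End.eigenspace (ρ m) c) hc
    (by
      rintro _ ⟨a, ha, rfl⟩ w hw
      rw [Module.End.mem_eigenspace_iff] at hw ⊢
      rw [← Module.End.mul_apply, ← map_mul, hM m m.2 a ha, map_mul, Module.End.mul_apply, hw,
        map_smul])
  choose! e he using fun (n : M) => hvF (ρ n) ⟨n, n.2, rfl⟩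
  refine ⟨⟨⟨e, ?_⟩, ?_⟩, ⟨v, hv0, he⟩, ?_⟩
  · apply smul_left_injective K hv0
    simp [← he]
  · intro a b
    apply smul_left_injective K hv0
    simp only [← he, Subgroup.coe_mul, map_mul, Module.End.mul_apply]
    rw [he b, map_smul, he a, smul_smul, mul_comm]
  · apply smul_left_injective K hv0
    change e m • v = c • v
    rw [← he, Module.End.mem_eigenspace_iff.1 hv]

/-- Every eigenvalue of `m / m'` is the value of a joint character, hence `1`, so `m / m'` is
unipotent. -/
theorem IsUnipotentFree.eq_of_jointCharacters [IsAlgClosed K] {ρ : G →* End K V}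
    (h : IsUnipotentFree ρ) (M : Subgroup G) (hM : ∀ a ∈ M, ∀ b ∈ M, a * b = b * a) (m m' : M)
    (heq : ∀ χ ∈ jointCharacters ρ M, χ m = χ m') : m = m' := by
  rw [← div_eq_one]
  ext
  refine h _ (Module.End.isNilpotent_of_forall_hasEigenvalue _ fun c hc => ?_)
  have : (ρ ((m / m' : M) : G)).HasEigenvalue (c + 1) := by
    obtain ⟨v, hv⟩ := hc.exists_hasEigenvector
    refine Module.End.hasEigenvalue_of_hasEigenvector (x := v)
      ⟨Module.End.mem_eigenspace_iff.2 ?_, hv.2⟩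
    have := hv.apply_eq_smul
    rw [LinearMap.sub_apply, Module.End.one_apply, sub_eq_iff_eq_add] at this
    rw [this, add_smul, one_smul]
  obtain ⟨χ, hχ, hval⟩ := exists_mem_jointCharacters ρ M hM _ _ this
  have h1 : χ (m / m') * χ m' = χ m' := by rw [← map_mul, div_mul_cancel, heq χ hχ]
  have h2 : χ m' ≠ 0 := ((Group.isUnit m').map χ).ne_zero
  rw [hval] at h1
  simpa [h2] using h1

/-- Elements of `G` acting alike on the finite set of joint characters conjugate `M` in the same
way. -/
theorem IsUnipotentFree.finiteIndex_centralizer [IsAlgClosed K] {ρ : G →* End K V}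
    (h : IsUnipotentFree ρ) (M : Subgroup G) [M.Normal] (hM : ∀ a ∈ M, ∀ b ∈ M, a * b = b * a) :
    (Subgroup.centralizer (M : Set G)).FiniteIndex := by
  have : Finite (jointCharacters ρ M) := finite_jointCharacters ρ M
  let f : G → jointCharacters ρ M → jointCharacters ρ M := fun g χ =>
    ⟨χ.1.comp (MulAut.conjNormal g).toMonoidHom, by
      obtain ⟨χ, v, hv, hχ⟩ := χ
      have hinv : ρ g (ρ g⁻¹ v) = v := by
        rw [← Module.End.mul_apply, ← map_mul, mul_inv_cancel, map_one, Module.End.one_apply]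
      refine ⟨ρ g⁻¹ v, fun h0 => hv (by rw [← hinv, h0, map_zero]), fun m => ?_⟩
      have := hχ (MulAut.conjNormal g m)
      simp only [MulAut.conjNormal_apply] at this
      rw [← Module.End.mul_apply, ← map_mul,
        show (m : G) * g⁻¹ = g⁻¹ * (g * m * g⁻¹) by group, map_mul, Module.End.mul_apply, this,
        map_smul]
      rfl⟩
  refine Subgroup.finiteIndex_of_map_to_finite _ f fun g g' hgg => ?_
  rw [Subgroup.mem_centralizer_iff]
  intro m hm
  have key : MulAut.conjNormal g ⟨m, hm⟩ = MulAut.conjNormal g' ⟨m, hm⟩ :=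
    h.eq_of_jointCharacters M hM _ _ fun χ hχ => by
      have := congrArg Subtype.val (congrFun hgg ⟨χ, hχ⟩)
      exact DFunLike.congr_fun this _
  have := congrArg Subtype.val key
  simp only [MulAut.conjNormal_apply] at this
  calc m * (g⁻¹ * g') = g⁻¹ * (g * m * g⁻¹) * g' := by group
    _ = g⁻¹ * g' * m := by rw [this]; group

/-- As `z` is central, `G` acts on its `c`-eigenspace. The determinant of this action kills
commutators, yet sends `z` to `c` to the dimension of the eigenspace. The factorial makes the
exponent uniform. -/
theorem pow_eq_one_of_mem_commutator (ρ : G →* End K V) (z : G)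
    (hz : z ∈ commutator G) (hc : z ∈ Subgroup.center G) (c : K) (h : (ρ z).HasEigenvalue c) :
    c ^ (finrank K V).factorial = 1 := by
  set W := Module.End.eigenspace (ρ z) c with hWdef
  have hW : ∀ g, ∀ w ∈ W, ρ g w ∈ W := by
    intro g w hw
    rw [Module.End.mem_eigenspace_iff] at hw ⊢
    rw [← Module.End.mul_apply, ← map_mul, ← Subgroup.mem_center_iff.1 hc g, map_mul,
      Module.End.mul_apply, hw, map_smul]
  let σ : G →* K :=
    { toFun := fun g => LinearMap.det ((ρ g).restrict (hW g))
      map_one' := by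
        have : (ρ 1).restrict (hW 1) = LinearMap.id := by ext; simp
        rw [this, LinearMap.det_id]
      map_mul' := fun a b => by
        rw [← LinearMap.det_comp]
        congr 1
        ext
        simp }
  have h1 : σ.toHomUnits z = 1 := Abelianization.commutator_subset_ker σ.toHomUnits hz
  have h2 : σ z = 1 := by simpa using congrArg Units.val h1
  have h3 : (ρ z).restrict (hW z) = c • LinearMap.id := by
    ext w
    simpa using Module.End.mem_eigenspace_iff.1 w.2
  have h4 : c ^ finrank K W = 1 := by
    have : σ z = LinearMap.det (c • (LinearMap.id : W →ₗ[K] W)) := by rw [← h3]; rfl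
    rw [← h2, this, LinearMap.det_smul, LinearMap.det_id, mul_one]
  have hpos : 0 < finrank K W := by
    have : Nontrivial W := Submodule.nontrivial_iff_ne_bot.2 h
    exact finrank_pos
  obtain ⟨k, hk⟩ := Nat.dvd_factorial hpos W.finrank_le
  rw [hk, pow_mul, h4, one_pow]

theorem IsUnipotentFree.finite_of_le_center_inf_commutator [IsAlgClosed K] {ρ : G →* End K V}
    (h : IsUnipotentFree ρ) (M : Subgroup G) (hM : M ≤ Subgroup.center G ⊓ commutator G) :
    Finite M := by
  have hcomm : ∀ a ∈ M, ∀ b ∈ M, a * b = b * a := fun a _ b hb =>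
    Subgroup.mem_center_iff.1 (hM hb).1 a
  have : Finite (jointCharacters ρ M) := finite_jointCharacters ρ M
  set n := (finrank K V).factorial with hn
  have : NeZero n := ⟨Nat.factorial_ne_zero _⟩
  have hfin : Finite {c : K // c ^ n = 1} := by
    classical
    refine Set.Finite.to_subtype
      ((Polynomial.nthRoots n (1 : K)).toFinset.finite_toSet.subset fun c hc => ?_)
    have hc' : c ^ n = 1 := hc
    simpa [Polynomial.mem_nthRoots (NeZero.pos n)] using hc'
  refine Finite.of_injective
    (fun (m : M) (χ : jointCharacters ρ M) => (⟨χ.1 m, ?_⟩ : {c : K // c ^ n = 1})) ?_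
  · obtain ⟨χ, v, hv, hχ⟩ := χ
    exact pow_eq_one_of_mem_commutator ρ m (hM m.2).2 (hM m.2).1 _
      (Module.End.hasEigenvalue_of_hasEigenvector ⟨Module.End.mem_eigenspace_iff.2 (hχ m), hv⟩)
  · intro m m' hmm
    exact h.eq_of_jointCharacters M hcomm m m' fun χ hχ =>
      congrArg Subtype.val (congrFun hmm ⟨χ, hχ⟩)

end Joint

/-! ### Solvable unipotent-free groups are virtually abelian. -/

section Solvable

variable {K V G : Type*} [Field K] [AddCommGroup V] [Module K V] [Group G]

theorem IsUnipotentFree.comp {G' : Type*} [Group G'] {ρ : G →* End K V} (h : IsUnipotentFree ρ)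
    (f : G' →* G) (hf : Function.Injective f) : IsUnipotentFree (ρ.comp f) := fun g hg =>
  (injective_iff_map_eq_one f).1 hf g (h (f g) hg)

variable [FiniteDimensional K V]

/-- The set `X` of elements with finite-index centralizer is stable under automorphisms and contains
`A`. Its centralizer commutes with `A`, so it lies in `X` and is therefore abelian. -/
theorem exists_characteristic_of_isVirtuallyAbelian (ρ : G →* End K V)
    (hρ : Function.Injective ρ) (h : IsVirtuallyAbelian G) :
    ∃ Z : Subgroup G, Z.Characteristic ∧ Z.FiniteIndex ∧ ∀ a ∈ Z, ∀ b ∈ Z, a * b = b * a := by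
  obtain ⟨A, hA, hcomm⟩ := h
  set X : Set G := {x | (Subgroup.centralizer {x}).FiniteIndex} with hX
  have hle : ∀ x, A ≤ Subgroup.centralizer {x} → x ∈ X := fun x hx =>
    Subgroup.finiteIndex_of_le hx
  have hAX : (A : Set G) ⊆ X := fun a ha => hle a fun b hb =>
    Subgroup.mem_centralizer_singleton_iff.2 (hcomm b hb a ha)
  refine ⟨Subgroup.centralizer X, ?_,
    Subgroup.finiteIndex_centralizer_of_faithful ρ hρ X fun x hx => hx, ?_⟩
  · rw [Subgroup.characteristic_iff_le_comap]
    intro φ z hz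
    rw [Subgroup.mem_comap, Subgroup.mem_centralizer_iff]
    intro x hx
    have hx' : φ.symm x ∈ X := by
      have hmap : (Subgroup.centralizer {x}).map (φ.symm : G →* G) ≤
          Subgroup.centralizer {φ.symm x} := by
        refine (Subgroup.map_centralizer_le_centralizer_image _ _).trans ?_
        simp
      have hfin : ((Subgroup.centralizer {x}).map (φ.symm : G →* G)).FiniteIndex :=
        ⟨by rw [Subgroup.index_map_equiv]; exact hx.index_ne_zero⟩
      exact Subgroup.finiteIndex_of_le hmap
    simpa using congrArg φ (Subgroup.mem_centralizer_iff.1 hz _ hx')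
  · intro a ha b hb
    refine Subgroup.mem_centralizer_iff.1 hb a (hle a fun c hc => ?_)
    exact Subgroup.mem_centralizer_singleton_iff.2 (Subgroup.mem_centralizer_iff.1 ha c (hAX hc))

theorem finiteIndex_center_of_finite_commutator (ρ : G →* End K V)
    (hρ : Function.Injective ρ) [Finite (commutator G)] : (Subgroup.center G).FiniteIndex := by
  rw [← Subgroup.centralizer_univ]
  refine Subgroup.finiteIndex_centralizer_of_faithful ρ hρ _ fun x _ => ?_
  refine Subgroup.finiteIndex_of_map_to_finite _
    (fun g => (⟨⁅g, x⁆, Subgroup.commutator_mem_commutator (Subgroup.mem_top g)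
      (Subgroup.mem_top x)⟩ : commutator G)) fun g g' h => ?_
  have h' : ⁅g, x⁆ = ⁅g', x⁆ := congrArg Subtype.val h
  rw [commutatorElement_def, commutatorElement_def, mul_left_inj] at h'
  rw [Subgroup.mem_centralizer_singleton_iff]
  calc g⁻¹ * g' * x = g⁻¹ * (g' * x * g'⁻¹) * g' := by group
    _ = x * (g⁻¹ * g') := by rw [← h']; group

/-- In the centralizer `C` of `M`, the intersection of `M` with `commutator C` is central, hence
finite, and has finite index in `commutator C`. So `commutator C` is finite and the center of `C`
has finite index. -/
theorem IsUnipotentFree.isVirtuallyAbelian_of_commutator [IsAlgClosed K] {ρ : G →* End K V}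
    (h : IsUnipotentFree ρ) (hG : IsVirtuallyAbelian (commutator G)) : IsVirtuallyAbelian G := by
  obtain ⟨Z, hZchar, hZfin, hZcomm⟩ := exists_characteristic_of_isVirtuallyAbelian
    (ρ.comp (commutator G).subtype) (h.comp _ Subtype.val_injective).injective hG
  set M : Subgroup G := Z.map (commutator G).subtype with hMdef
  have hMnormal : M.Normal := inferInstance
  have hMcomm : ∀ a ∈ M, ∀ b ∈ M, a * b = b * a := by
    rintro _ ⟨a, ha, rfl⟩ _ ⟨b, hb, rfl⟩
    simpa using congrArg Subtype.val (hZcomm a ha b hb)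
  set C : Subgroup G := Subgroup.centralizer (M : Set G) with hC
  have hCfin : C.FiniteIndex := h.finiteIndex_centralizer M hMcomm
  refine IsVirtuallyAbelian.of_finiteIndex C ?_
  have hCU : IsUnipotentFree (ρ.comp C.subtype) := h.comp _ Subtype.val_injective
  have hDle : (commutator C).map C.subtype ≤ commutator G := by
    rw [Subgroup.map_subtype_commutator]
    exact Subgroup.commutator_mono le_top le_top
  have hfin : Finite (M.subgroupOf C ⊓ commutator C : Subgroup C) := by
    refine hCU.finite_of_le_center_inf_commutator _ (inf_le_inf_right _ fun c hc => ?_)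
    rw [Subgroup.mem_center_iff]
    intro g
    exact Subtype.ext (Subgroup.mem_centralizer_iff.1 g.2 c hc).symm
  have hrel : (M.subgroupOf C).relIndex (commutator C) ≠ 0 := by
    rw [Subgroup.subgroupOf, Subgroup.relIndex_comap]
    refine fun h0 => hZfin.index_ne_zero ?_
    rw [← Subgroup.comap_map_eq_self_of_injective (commutator G).subtype_injective Z]
    exact Subgroup.relIndex_eq_zero_of_le_right hDle h0
  have hD : Finite (commutator C) := by
    apply Nat.finite_of_card_ne_zero
    rw [← Subgroup.relIndex_bot_left]
    refine Subgroup.relIndex_ne_zero_trans (K := M.subgroupOf C ⊓ commutator C) ?_ ?_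
    · rw [Subgroup.relIndex_bot_left]
      exact Nat.card_pos.ne'
    · rwa [Subgroup.inf_relIndex_right]
  have := finiteIndex_center_of_finite_commutator _ hCU.injective
  exact ⟨Subgroup.center C, this, fun a _ b hb => Subgroup.mem_center_iff.1 hb a⟩

theorem IsUnipotentFree.isVirtuallyAbelian [IsAlgClosed K] {ρ : G →* End K V}
    (h : IsUnipotentFree ρ) (hG : Group.IsSolvable G) : IsVirtuallyAbelian G := by
  obtain ⟨n, hn⟩ := hG.solvable
  -- Induction from the trivial last term of the derived series up to `G`.
  have key : ∀ i ≤ n, IsVirtuallyAbelian (derivedSeries G (n - i)) := by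
    intro i
    induction i with
    | zero =>
      intro _
      refine ⟨⊤, inferInstance, fun a _ b _ => ?_⟩
      have : Subsingleton (derivedSeries G (n - 0)) := by
        rw [Nat.sub_zero, hn]; infer_instance
      exact Subsingleton.elim _ _
    | succ i ih =>
      intro hi
      refine (h.comp (derivedSeries G (n - (i + 1))).subtype
        Subtype.val_injective).isVirtuallyAbelian_of_commutator ?_
      have hi' := ih (by omega)
      rw [show n - i = n - (i + 1) + 1 by omega, derivedSeries_succ,
        ← Subgroup.map_subtype_commutator] at hi'
      exact hi'.of_mulEquiv
        ((commutator _).equivMapOfInjective _ (Subgroup.subtype_injective _)).symm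
  have h0 := key n le_rfl
  rw [Nat.sub_self, derivedSeries_zero] at h0
  exact h0.of_mulEquiv Subgroup.topEquiv

end Solvable

open Polynomial

open scoped IntermediateField

/-! ### Finitely generated commutative groups. -/

section FinitelyGenerated

theorem Subgroup.FG.of_map_of_ker {A B : Type*} [CommGroup A] [CommGroup B] [Group.FG B]
    (f : A →* B) (H K : Subgroup A) (hK : K.FG) (h : ∀ x ∈ H, f x = 1 → x ∈ K) : H.FG := by
  have hB : Module.Finite ℤ (Additive B) :=
    Module.Finite.iff_addGroup_fg.2 (GroupFG.iff_add_fg.1 ‹_›)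
  let toSub : Subgroup A → Submodule ℤ (Additive A) := fun P =>
    AddSubgroup.toIntSubmodule P.toAddSubgroup
  have hfg : ∀ P : Subgroup A, P.FG ↔ (toSub P).FG := fun P => by
    rw [Submodule.fg_iff_addSubgroup_fg, AddSubgroup.toIntSubmodule_toAddSubgroup,
      Subgroup.fg_iff_add_fg]
  rw [hfg] at hK ⊢
  refine Submodule.fg_of_fg_map_of_fg_inf_ker (MonoidHom.toAdditive f).toIntLinearMap
    (IsNoetherian.noetherian _) ?_
  have : IsNoetherian ℤ (toSub K) := isNoetherian_of_fg_of_noetherian _ hK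
  have hle : toSub H ⊓ LinearMap.ker (MonoidHom.toAdditive f).toIntLinearMap ≤ toSub K := by
    rintro x ⟨hx, hx'⟩
    exact h (Additive.toMul x) hx hx'
  have := IsNoetherian.noetherian (Submodule.comap (toSub K).subtype
    (toSub H ⊓ LinearMap.ker (MonoidHom.toAdditive f).toIntLinearMap))
  have h2 := this.map (toSub K).subtype
  rwa [Submodule.map_comap_subtype, inf_eq_right.2 hle] at h2

theorem Subgroup.FG.of_le {A : Type*} [CommGroup A] {H K : Subgroup A} (hK : K.FG) (h : H ≤ K) :
    H.FG :=
  .of_map_of_ker (1 : A →* Unit) H K hK fun _ hx _ => h hx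

theorem Group.FG.of_forall_range {A ι : Type*} [CommGroup A] [Finite ι] {B : ι → Type*}
    [∀ i, CommGroup (B i)] (f : ∀ i, A →* B i) (hf : ∀ i, (f i).range.FG)
    (h : ∀ a, (∀ i, f i a = 1) → a = 1) : Group.FG A := by
  have (i : ι) : Group.FG (f i).range := (Group.fg_iff_subgroup_fg _).2 (hf i)
  rw [Group.fg_def]
  refine .of_map_of_ker (MonoidHom.pi fun i => (f i).rangeRestrict) ⊤ ⊥ .bot fun a _ ha => ?_
  exact h a fun i => congrArg Subtype.val (congrFun ha i)

end FinitelyGenerated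

/-! ### Integral units: valuations and specialisation. -/

section IntegralUnits

/-- The units `u` of `L` such that `u` and `u⁻¹` are integral over the subring generated by `s`. -/
def integralUnits {L : Type*} [Field L] (s : Set L) : Subgroup Lˣ where
  carrier := {u | IsIntegral (Subring.closure s) (u : L) ∧
    IsIntegral (Subring.closure s) ((u⁻¹ : Lˣ) : L)}
  one_mem' := by simpa using isIntegral_one
  mul_mem' := fun {a b} ha hb => ⟨by simpa using ha.1.mul hb.1, by
    rw [mul_inv_rev, Units.val_mul]; exact hb.2.mul ha.2⟩
  inv_mem' := fun {a} ha => ⟨ha.2, by simpa using ha.1⟩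

/-- A field has finitely generated integral units if, for each finitely generated subring, the
units integral over the subring along with their inverses form a finitely generated group. -/
def HasFGIntegralUnits (L : Type*) [Field L] : Prop :=
  ∀ s : Finset L, (integralUnits (s : Set L)).FG

theorem IsIntegral.map_closure {A B : Type*} [CommRing A] [CommRing B] (ψ : A →+* B) {s : Set A}
    {t : Set B} (hst : ψ '' s ⊆ t) {x : A} (hx : IsIntegral (Subring.closure s) x) :
    IsIntegral (Subring.closure t) (ψ x) := by
  have h : ∀ a ∈ Subring.closure s, ψ a ∈ Subring.closure t := fun a ha => by
    have : Subring.closure s ≤ (Subring.closure t).comap ψ :=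
      Subring.closure_le.2 fun y hy => Subring.subset_closure (hst ⟨y, hy, rfl⟩)
    exact this ha
  exact hx.map_of_comp_eq (ψ.restrict (Subring.closure s) (Subring.closure t) h) ψ (by ext; rfl)

theorem HasFGIntegralUnits.of_ringHom {L M : Type*} [Field L] [Field M] (ψ : L →+* M)
    (h : HasFGIntegralUnits M) : HasFGIntegralUnits L := by
  classical
  intro s
  have hle : (integralUnits (s : Set L)).map (Units.map (ψ : L →* M)) ≤
      integralUnits ((s.image ψ : Finset M) : Set M) := by
    rintro _ ⟨u, hu, rfl⟩
    have hsub : ψ '' (s : Set L) ⊆ ((s.image ψ : Finset M) : Set M) := by simp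
    refine ⟨by simpa using hu.1.map_closure ψ hsub, by simpa using hu.2.map_closure ψ hsub⟩
  refine (Subgroup.fg_iff_submonoid_fg _).2 (Submonoid.FG.map_injective _
    (Units.map_injective (f := (ψ : L →* M)) ψ.injective) ?_)
  exact (Subgroup.fg_iff_submonoid_fg _).1 ((h (s.image ψ)).of_le hle)

theorem HasFGIntegralUnits.of_finite (L : Type*) [Field L] [Finite L] : HasFGIntegralUnits L :=
  fun _ => (Group.fg_iff_subgroup_fg _).1 Group.fg_of_finite

open IsDedekindDomain in
/-- Integral units of the fraction field of a Dedekind domain are finitely generated modulo the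
units of the Dedekind domain. -/
theorem Subgroup.FG.of_isDedekindDomain (C : Type*) {L : Type*} [CommRing C] [IsDedekindDomain C]
    [Field L] [Algebra C L] [IsFractionRing C L] (s : Finset L) (H K : Subgroup Lˣ)
    (hH : H ≤ integralUnits (s : Set L)) (hK : K.FG)
    (h : ∀ u ∈ H, (u : L) ∈ (algebraMap C L).range → ((u⁻¹ : Lˣ) : L) ∈ (algebraMap C L).range →
      u ∈ K) : H.FG := by
  -- `T` is the finite set of primes at which a generator has a pole. At any other prime the
  -- valuation ring contains everything integral over the subring, so valuations need recording only
  -- on `T`.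
  set T : Set (HeightOneSpectrum C) := ⋃ x ∈ s, HeightOneSpectrum.Support C x with hT
  have hTfin : T.Finite := s.finite_toSet.biUnion fun x _ => HeightOneSpectrum.Support.finite C x
  have hint : ∀ v ∉ T, ∀ x : L, IsIntegral (Subring.closure (s : Set L)) x →
      v.valuation L x ≤ 1 := by
    intro v hv x hx
    have hle : Subring.closure (s : Set L) ≤ (v.valuation L).valuationSubring.toSubring := by
      refine Subring.closure_le.2 fun y hy => ?_
      change v.valuation L y ≤ 1
      by_contra hlt
      exact hv (Set.mem_biUnion hy (not_le.1 hlt))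
    have hx' : x ∈ (integralClosure (Subring.closure (s : Set L)) L).toSubring := hx
    rw [← iInf_valuationSubring_superset, Subring.mem_iInf] at hx'
    exact hx' ⟨(v.valuation L).valuationSubring, Subring.closure_le.1 hle⟩
  have : Finite T := hTfin
  let φ : Lˣ →* (T → Multiplicative ℤ) := MonoidHom.pi fun v => v.1.valuationOfNeZero
  refine .of_map_of_ker φ H K hK fun u hu hφ => ?_
  have hone : ∀ v : HeightOneSpectrum C, ∀ w ∈ H, φ w = 1 → v.valuation L (w : L) ≤ 1 := by
    intro v w hw hφ
    by_cases hv : v ∈ T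
    · rw [← HeightOneSpectrum.valuationOfNeZero_eq]
      have : v.valuationOfNeZero w = 1 := congrFun hφ ⟨v, hv⟩
      rw [this]
      exact le_rfl
    · exact hint v hv _ (hH hw).1
  exact h u hu (HeightOneSpectrum.mem_integers_of_valuation_le_one L _ fun v => hone v u hu hφ)
    (HeightOneSpectrum.mem_integers_of_valuation_le_one L _ fun v =>
      hone v u⁻¹ (H.inv_mem hu) (by rw [map_inv, hφ, inv_one]))

theorem HasFGIntegralUnits.of_numberField (L : Type*) [Field L] [NumberField L] :
    HasFGIntegralUnits L := by
  intro s
  have : Group.FG (NumberField.RingOfIntegers L)ˣ := Group.fg_iff_monoid_fg.2 inferInstance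
  refine .of_isDedekindDomain (NumberField.RingOfIntegers L) s _
    (Units.map (algebraMap (NumberField.RingOfIntegers L) L).toMonoidHom).range le_rfl
    ((Group.fg_iff_subgroup_fg _).1 inferInstance) ?_
  rintro u - ⟨a, ha⟩ ⟨b, hb⟩
  have hinj := FaithfulSMul.algebraMap_injective (NumberField.RingOfIntegers L) L
  refine ⟨⟨a, b, hinj ?_, hinj ?_⟩, Units.ext ha⟩
  · rw [map_mul, ha, hb, map_one, Units.mul_inv]
  · rw [map_mul, ha, hb, map_one, Units.inv_mul]

theorem exists_algHom_finite_of_finiteType.{u, v} (k : Type u) (B : Type v) [Field k] [CommRing B] [Nontrivial B]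
    [Algebra k B] [Algebra.FiniteType k B] :
    ∃ (M : Type v) (_ : Field M) (_ : Algebra k M), Module.Finite k M ∧ Nonempty (B →ₐ[k] M) := by
  obtain ⟨m, hm⟩ := Ideal.exists_maximal B
  let : Field (B ⧸ m) := Ideal.Quotient.field m
  exact ⟨B ⧸ m, inferInstance, inferInstance, finite_of_finite_type_of_isJacobsonRing k (B ⧸ m),
    ⟨Ideal.Quotient.mkₐ k m⟩⟩

/-- By specialisation, integrality over a finitely generated subring of an extension of a field
`k` implies integrality over a finitely generated subring of `k`. -/
theorem exists_finset_isIntegral_of_isIntegral_algebraMap (k L : Type*) [Field k] [Field L]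
    [Algebra k L] (s : Finset L) : ∃ t : Finset k, ∀ u : k,
      IsIntegral (Subring.closure (s : Set L)) (algebraMap k L u) →
      IsIntegral (Subring.closure (t : Set k)) u := by
  classical
  let B := Algebra.adjoin k (s : Set L)
  have : Algebra.FiniteType k B := (Subalgebra.fg_iff_finiteType _).1 (Subalgebra.fg_adjoin_finset s)
  -- Zariski's lemma gives the specialisation. The set `t` below collects the coefficients of the
  -- minimal polynomials of the images of `s`, making those images integral over `R`; the default
  -- value `0` never occurs for `x ∈ s`.
  obtain ⟨M, _, _, _, ⟨π⟩⟩ := exists_algHom_finite_of_finiteType k B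
  have hint : Algebra.IsIntegral k M := Algebra.IsIntegral.of_finite k M
  let c : L → k[X] := fun x =>
    if hx : x ∈ B then minpoly k (π ⟨x, hx⟩) else 0
  let t : Finset k := s.biUnion fun x => (c x).coeffs
  refine ⟨t, fun u hu => ?_⟩
  set R := Subring.closure (t : Set k) with hR
  have hB : ∀ x ∈ s, x ∈ B := fun x hx => Algebra.subset_adjoin hx
  have hs : ∀ x (hx : x ∈ s), IsIntegral R (π ⟨x, hB x hx⟩) := by
    intro x hx
    have hcx : c x = minpoly k (π ⟨x, hB x hx⟩) := dif_pos (hB x hx)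
    have hcoeff : ((c x).coeffs : Set k) ⊆ R := fun y hy => Subring.subset_closure
      (Finset.mem_coe.2 (Finset.mem_biUnion.2 ⟨x, hx, hy⟩))
    refine ⟨(c x).toSubring R hcoeff, ?_, ?_⟩
    · rw [Polynomial.monic_toSubring, hcx]
      exact minpoly.monic (hint.isIntegral _)
    · have : (((c x).toSubring R hcoeff).map R.subtype) = c x := Polynomial.map_toSubring _ _ _
      rw [show algebraMap R M = (algebraMap k M).comp R.subtype from rfl,
        ← Polynomial.eval₂_map, this, hcx]
      exact minpoly.aeval k _
  set C := integralClosure R M with hC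
  have hcl : ∀ x ∈ Subring.closure (s : Set L), ∃ hx : x ∈ B, π ⟨x, hx⟩ ∈ C := by
    have : Subring.closure (s : Set L) ≤ (C.toSubring.comap (π : B →+* M)).map
        (B.val : B →+* L) :=
      Subring.closure_le.2 fun x hx => ⟨⟨x, hB x hx⟩, hs x hx, rfl⟩
    intro x hx
    obtain ⟨b, hb, rfl⟩ := this hx
    exact ⟨b.2, hb⟩
  obtain ⟨p, hp, hpu⟩ := hu
  let g : Subring.closure (s : Set L) →+* B := (Subring.closure (s : Set L)).subtype.codRestrict
    B fun x => (hcl x x.2).1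
  let g' : Subring.closure (s : Set L) →+* C := ((π : B →+* M).comp g).codRestrict C
    fun x => (hcl x x.2).2
  have hpB : p.eval₂ g (algebraMap k B u) = 0 := by
    refine Subtype.val_injective ?_
    change (B.val : B →+* L) _ = 0
    rw [Polynomial.hom_eval₂]
    exact hpu
  have hpM : IsIntegral C (algebraMap k M u) := by
    refine ⟨p.map g', hp.map g', ?_⟩
    rw [Polynomial.eval₂_map]
    have := congrArg (π : B →+* M) hpB
    rw [Polynomial.hom_eval₂, map_zero] at this
    rw [← this]
    congr 1
    exact (π.commutes u).symm
  have hR' : IsIntegral R (algebraMap k M u) := isIntegral_trans _ hpM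
  exact (isIntegral_algebraMap_iff (algebraMap k M).injective).1 hR'

end IntegralUnits

/-! ### Adjoining one element to the base field. -/

section FunctionField

theorem isFractionRing_adjoin_of_eq_top {k K : Type*} [Field k] [Field K] [Algebra k K] {t : K}
    (ht : k⟮t⟯ = ⊤) : IsFractionRing (Algebra.adjoin k {t}) K :=
  .of_field _ _ fun z => by
    obtain ⟨x, hx, y, hy, rfl⟩ := IntermediateField.mem_adjoin_iff_div.1
      (ht ▸ IntermediateField.mem_top : z ∈ k⟮t⟯)
    exact ⟨⟨x, hx⟩, ⟨y, hy⟩, rfl⟩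

theorem isPrincipalIdealRing_adjoin_singleton {k K : Type*} [Field k] [Field K] [Algebra k K]
    (t : K) : IsPrincipalIdealRing (Algebra.adjoin k {t}) := by
  let f : k[X] →ₐ[k] Algebra.adjoin k {t} := (aeval t).codRestrict _ fun p =>
    aeval_mem_adjoin_singleton k t
  refine IsPrincipalIdealRing.of_surjective (f : k[X] →+* Algebra.adjoin k {t}) ?_
  rintro ⟨x, hx⟩
  rw [Algebra.adjoin_singleton_eq_range_aeval] at hx
  obtain ⟨p, rfl⟩ := hx
  exact ⟨p, rfl⟩

/-- Otherwise some valuation ring over the integral closure of `k` omits `u`. It contains `t` or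
`t⁻¹` and is integrally closed, a contradiction. -/
theorem isIntegral_of_isIntegral_adjoin_inv {k L : Type*} [Field k] [Field L] [Algebra k L]
    {t u : L} (h : IsIntegral (Algebra.adjoin k {t}) u)
    (h' : IsIntegral (Algebra.adjoin k {t⁻¹}) u) : IsIntegral k u := by
  by_contra hu
  obtain ⟨V, hV, huV⟩ := Subring.exists_le_valuationSubring_of_isIntegrallyClosedIn
    (R := (integralClosure k L).toSubring) (x := u) hu
  have key : ∀ x ∈ V, ¬ IsIntegral (Algebra.adjoin k {x}) u := by
    intro x hx hux
    let A : Subalgebra k L :=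
      { V.toSubring with
        algebraMap_mem' := fun r => hV (algebraMap_mem (integralClosure k L) r) }
    have hle : Algebra.adjoin k {x} ≤ A := Algebra.adjoin_le
      (Set.singleton_subset_iff.2 hx)
    have hint : IsIntegral V u := hux.map_of_comp_eq
      ((Subalgebra.inclusion hle : _ →+* A) : Algebra.adjoin k {x} →+* V) (RingHom.id L)
      (by ext; rfl)
    obtain ⟨y, rfl⟩ := IsIntegrallyClosed.isIntegral_iff.1 hint
    exact huV y.2
  exact (V.mem_or_inv_mem t).elim (fun ht => key _ ht h) fun ht => key _ ht h'

/-- Since `t` stays transcendental over the constants `L₀`, a `k`-basis of `L₀` remains independent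
over `k[t]`, hence over `K`. -/
theorem finiteDimensional_algebraicClosure {k K L : Type*} [Field k] [Field K] [Field L]
    [Algebra k K] [Algebra K L] [Algebra k L] [IsScalarTower k K L] [FiniteDimensional K L]
    {t : K} (ht : k⟮t⟯ = ⊤) (htr : Transcendental k t) :
    FiniteDimensional k (algebraicClosure k L) := by
  set L₀ := algebraicClosure k L with hL₀
  have hFrac := isFractionRing_adjoin_of_eq_top ht
  let tL : L := algebraMap K L t
  have htrL : Transcendental L₀ tL :=
    ((transcendental_algebraMap_iff (algebraMap K L).injective).2 htr).extendScalars L₀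
  let b := Module.Basis.ofVectorSpace k L₀
  have hli : LinearIndependent K (fun i => (b i : L)) := by
    rw [← LinearIndependent.iff_fractionRing (Algebra.adjoin k {t}) K, linearIndependent_iff']
    intro s g hg i hi
    have hex : ∀ j, ∃ p : k[X], aeval t p = (g j : K) := fun j =>
      (Algebra.adjoin_singleton_eq_range_aeval k t).le (g j).2
    choose p hp using hex
    let P : L₀[X] := ∑ j ∈ s, C (b j) * (p j).map (algebraMap k L₀)
    have hP : aeval tL P = 0 := by
      rw [← hg, map_sum]
      refine Finset.sum_congr rfl fun j _ => ?_
      rw [map_mul, aeval_C, aeval_map_algebraMap, aeval_algebraMap_apply, hp, Algebra.smul_def,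
        mul_comm]
      rfl
    have hP0 : P = 0 := by
      by_contra hne
      exact htrL ⟨P, hne, hP⟩
    have hcoeff : ∀ n, (p i).coeff n = 0 := by
      intro n
      have h1 : ∑ j ∈ s, (p j).coeff n • b j = 0 := by
        have := congrArg (fun Q => Q.coeff n) hP0
        simp only [P, finsetSum_coeff, coeff_C_mul, coeff_map, coeff_zero] at this
        rw [← this]
        refine Finset.sum_congr rfl fun j _ => ?_
        rw [Algebra.smul_def, mul_comm]
      exact linearIndependent_iff'.1 b.linearIndependent s _ h1 i hi
    have : p i = 0 := Polynomial.ext hcoeff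
    ext
    rw [← hp i, this, map_zero]
    rfl
  have : Finite (Module.Basis.ofVectorSpaceIndex k L₀) := hli.finite
  exact Module.Finite.of_basis b

/-- All finite extensions of the field have finitely generated integral units. -/
def FiniteExtensionsHaveFGIntegralUnits.{u} (k : Type u) [Field k] : Prop :=
  ∀ (L : Type u) [Field L] [Algebra k L], FiniteDimensional k L → HasFGIntegralUnits L

/-- Integral units with respect to the integral closure of `k[t]` in a finite separable extension
of `k(t)`. -/
theorem Subgroup.FG.of_adjoin {k K L : Type*} [Field k] [Field K] [Field L]
    [Algebra k K] [Algebra K L] [FiniteDimensional K L] [Algebra.IsSeparable K L]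
    {t : K} (ht : k⟮t⟯ = ⊤) (s : Finset L) (H M : Subgroup Lˣ)
    (hH : H ≤ integralUnits (s : Set L)) (hM : M.FG)
    (h : ∀ u ∈ H, IsIntegral (Algebra.adjoin k {t}) (u : L) →
      IsIntegral (Algebra.adjoin k {t}) ((u⁻¹ : Lˣ) : L) → u ∈ M) : H.FG := by
  have hFrac := isFractionRing_adjoin_of_eq_top ht
  have hPID := isPrincipalIdealRing_adjoin_singleton (k := k) t
  have hDed : IsDedekindDomain (integralClosure (Algebra.adjoin k {t}) L) :=
    integralClosure.isDedekindDomain _ K L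
  have hFrac' : IsFractionRing (integralClosure (Algebra.adjoin k {t}) L) L :=
    IsIntegralClosure.isFractionRing_of_finite_extension (Algebra.adjoin k {t}) K L _
  refine .of_isDedekindDomain (integralClosure (Algebra.adjoin k {t}) L) s H M hH hM ?_
  rintro u hu ⟨x, hx⟩ ⟨y, hy⟩
  exact h u hu (hx ▸ x.2) (hy ▸ y.2)

theorem IsIntegral.adjoin_algebraMap {k K L : Type*} [Field k] [Field K] [Field L]
    [Algebra k K] [Algebra K L] [Algebra k L] [IsScalarTower k K L] {t : K} {u : L}
    (h : IsIntegral (Algebra.adjoin k {t}) u) :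
    IsIntegral (Algebra.adjoin k {algebraMap K L t}) u := by
  have hmap : ∀ x : Algebra.adjoin k {t},
      algebraMap K L x ∈ Algebra.adjoin k {algebraMap K L t} := fun x => by
    have : algebraMap K L x ∈ (Algebra.adjoin k {t}).map (IsScalarTower.toAlgHom k K L) :=
      ⟨x, x.2, rfl⟩
    rw [AlgHom.map_adjoin] at this
    simpa using this
  exact h.map_of_comp_eq (((algebraMap K L).comp (Algebra.adjoin k {t}).val.toRingHom).codRestrict
    (Algebra.adjoin k {algebraMap K L t}) hmap) (RingHom.id L) (by ext; rfl)

/-- Valuations over `k[t]` and then over `k[t⁻¹]` reduce to units integral over both rings. These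
are constants, and specialisation makes them integral units of `L₀`. -/
theorem HasFGIntegralUnits.of_transcendental_of_isSeparable.{u} {k K L : Type u} [Field k]
    [Field K] [Field L] [Algebra k K] [Algebra K L] [Algebra k L] [IsScalarTower k K L]
    [FiniteDimensional K L] [Algebra.IsSeparable K L] {t : K} (ht : k⟮t⟯ = ⊤)
    (htr : Transcendental k t) (hk : FiniteExtensionsHaveFGIntegralUnits k) :
    HasFGIntegralUnits L := by
  intro s
  let L₀ := algebraicClosure k L
  have hL₀ : HasFGIntegralUnits L₀ := hk L₀ (finiteDimensional_algebraicClosure ht htr)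
  obtain ⟨t₀, ht₀⟩ := exists_finset_isIntegral_of_isIntegral_algebraMap L₀ L s
  have htinv : k⟮t⁻¹⟯ = ⊤ := by
    rw [eq_top_iff, ← ht, IntermediateField.adjoin_simple_le_iff]
    simpa using inv_mem (IntermediateField.mem_adjoin_simple_self k t⁻¹)
  let C := integralClosure (Algebra.adjoin k {t}) L
  have h1 : ((integralUnits (t₀ : Set L₀)).map (Units.map (algebraMap L₀ L).toMonoidHom)).FG :=
    (Subgroup.fg_iff_submonoid_fg _).2 (((Subgroup.fg_iff_submonoid_fg _).1 (hL₀ t₀)).map _)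
  have h2 : (integralUnits (s : Set L) ⊓ C.toSubmonoid.units).FG := by
    refine .of_adjoin htinv s _ _ inf_le_left h1 fun u hu hu1 hu2 => ?_
    have hC := (Submonoid.mem_units_iff _ _).1 hu.2
    have halg : ∀ x : L, x ∈ C → IsIntegral (Algebra.adjoin k {t⁻¹}) x → x ∈ L₀ := by
      intro x hx hx'
      have hx2 := hx'.adjoin_algebraMap
      rw [map_inv₀] at hx2
      exact mem_algebraicClosure_iff.2
        (isIntegral_of_isIntegral_adjoin_inv (IsIntegral.adjoin_algebraMap hx) hx2).isAlgebraic
    have hx := halg _ hC.1 hu1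
    have hy := halg _ hC.2 hu2
    exact ⟨⟨⟨u, hx⟩, ⟨(u⁻¹ : Lˣ), hy⟩, Subtype.ext u.mul_inv, Subtype.ext u.inv_mul⟩,
      ⟨ht₀ ⟨u, hx⟩ hu.1.1, ht₀ ⟨_, hy⟩ hu.1.2⟩, Units.ext rfl⟩
  exact .of_adjoin ht s _ _ le_rfl h2 fun u hu hu1 hu2 =>
    ⟨hu, (Submonoid.mem_units_iff _ _).2 ⟨hu1, hu2⟩⟩

/-- A power of Frobenius embeds `L` into `K`. -/
theorem HasFGIntegralUnits.of_isPurelyInseparable {K L : Type*} [Field K] [Field L] [Algebra K L]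
    [FiniteDimensional K L] [IsPurelyInseparable K L] (h : HasFGIntegralUnits K) :
    HasFGIntegralUnits L := by
  obtain ⟨p, hp⟩ := ExpChar.exists K
  exact h.of_ringHom (IsPurelyInseparable.iterateFrobenius K L p le_rfl)

theorem FiniteExtensionsHaveFGIntegralUnits.of_adjoin_eq_top.{u} {k K : Type u} [Field k]
    [Field K] [Algebra k K] {t : K} (ht : k⟮t⟯ = ⊤)
    (hk : FiniteExtensionsHaveFGIntegralUnits k) : FiniteExtensionsHaveFGIntegralUnits K := by
  intro L _ _ hL
  let : Algebra k L := ((algebraMap K L).comp (algebraMap k K)).toAlgebra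
  have : IsScalarTower k K L := .of_algebraMap_eq fun _ => rfl
  by_cases htr : Transcendental k t
  · have : HasFGIntegralUnits (separableClosure K L) :=
      .of_transcendental_of_isSeparable (k := k) ht htr hk
    exact .of_isPurelyInseparable this
  · have hfin : FiniteDimensional k k⟮t⟯ :=
      IntermediateField.adjoin.finiteDimensional (not_not.1 htr).isIntegral
    rw [ht] at hfin
    have : FiniteDimensional k K := Module.Finite.equiv
      (IntermediateField.topEquiv (F := k) (E := K)).toLinearEquiv
    exact hk L (FiniteDimensional.trans k K L)

end FunctionField

/-! ### Induction on field generators, starting from the prime field. -/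

section FGFields

theorem exists_subfield_finiteExtensionsHaveFGIntegralUnits.{u} {F : Type u} [Field F]
    (e : Finset F) :
    ∃ k : Subfield F, (e : Set F) ⊆ k ∧ FiniteExtensionsHaveFGIntegralUnits k := by
  -- The induction starts at the copy `⊥` of the prime field inside `F`, which lives in the universe
  -- of `F`.
  have step : ∀ (F₀ : Type) [Field F₀] [Algebra F₀ F],
      FiniteExtensionsHaveFGIntegralUnits (⊥ : IntermediateField F₀ F) →
      ∃ k : Subfield F, (e : Set F) ⊆ k ∧ FiniteExtensionsHaveFGIntegralUnits k := by
    intro F₀ _ _ hbot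
    refine ⟨(IntermediateField.adjoin F₀ (e : Set F)).toSubfield,
      IntermediateField.subset_adjoin F₀ _, ?_⟩
    refine IntermediateField.induction_on_adjoin_finset e
      (fun K => FiniteExtensionsHaveFGIntegralUnits K) hbot fun K x _ hK => ?_
    have htop : K⟮IntermediateField.AdjoinSimple.gen K x⟯ = ⊤ := by
      refine eq_top_iff.2 fun y _ => ?_
      obtain ⟨p, q, hpq⟩ := (IntermediateField.mem_adjoin_simple_iff K (y : F)).1 y.2
      refine (IntermediateField.mem_adjoin_simple_iff K y).2 ⟨p, q, Subtype.ext ?_⟩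
      simpa using hpq
    exact hK.of_adjoin_eq_top (K := K⟮x⟯) htop
  obtain ⟨p, hp⟩ := CharP.exists F
  rcases CharP.char_is_prime_or_zero F p with hprime | rfl
  · have : Fact p.Prime := ⟨hprime⟩
    let : Algebra (ZMod p) F := ZMod.algebra F p
    refine step (ZMod p) fun L _ _ _ => ?_
    have : Finite (⊥ : IntermediateField (ZMod p) F) := Module.finite_of_finite (ZMod p)
    have : Finite L := Module.finite_of_finite (⊥ : IntermediateField (ZMod p) F)
    exact .of_finite L
  · have : CharZero F := CharP.charP_to_charZero F
    refine step ℚ fun L _ _ _ => ?_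
    have : CharZero L :=
      charZero_of_injective_algebraMap (algebraMap (⊥ : IntermediateField ℚ F) L).injective
    have : IsScalarTower ℚ (⊥ : IntermediateField ℚ F) L := inferInstance
    have : FiniteDimensional ℚ L := Module.Finite.trans (⊥ : IntermediateField ℚ F) L
    have : NumberField L := ⟨⟩
    exact .of_numberField L

end FGFields

/-! ### Commutative unipotent-free matrix groups. -/

section Abelian

theorem group_fg_of_isIntegral_of_unipotentFree.{u, v} {k E : Type u} {A : Type v} [Field k]
    (hk : FiniteExtensionsHaveFGIntegralUnits k) [CommRing E] [Algebra k E] [Module.Finite k E]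
    [CommGroup A] (σ : A →* E) (hσ : ∀ a, IsNilpotent (σ a - 1) → a = 1) (e : Finset k)
    (he : ∀ a, IsIntegral (Subring.closure (e : Set k)) (σ a)) : Group.FG A := by
  classical
  have : IsArtinianRing E := IsArtinianRing.of_finite k E
  let f : ∀ m : MaximalSpectrum E, A →* (E ⧸ m.asIdeal)ˣ := fun m =>
    ((Ideal.Quotient.mk m.asIdeal : E →* E ⧸ m.asIdeal).comp σ).toHomUnits
  let hfield : ∀ m : MaximalSpectrum E, Field (E ⧸ m.asIdeal) := fun m =>
    Ideal.Quotient.field m.asIdeal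
  refine Group.FG.of_forall_range f (fun m => ?_) fun a ha => ?_
  · have hQ : HasFGIntegralUnits (E ⧸ m.asIdeal) := hk (E ⧸ m.asIdeal) inferInstance
    let s : Finset (E ⧸ m.asIdeal) := e.image (algebraMap k (E ⧸ m.asIdeal))
    have hint : ∀ a, IsIntegral (Subring.closure (s : Set (E ⧸ m.asIdeal)))
        (Ideal.Quotient.mk m.asIdeal (σ a)) := by
      intro a
      have hle : ∀ x ∈ Subring.closure (e : Set k), algebraMap k (E ⧸ m.asIdeal) x ∈
          Subring.closure (s : Set (E ⧸ m.asIdeal)) := fun x hx => by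
        have : Subring.closure (e : Set k) ≤
            (Subring.closure (s : Set (E ⧸ m.asIdeal))).comap (algebraMap k (E ⧸ m.asIdeal)) :=
          Subring.closure_le.2 fun y hy =>
            Subring.subset_closure (Finset.mem_coe.2 (Finset.mem_image_of_mem _ hy))
        exact this hx
      exact (he a).map_of_comp_eq ((algebraMap k (E ⧸ m.asIdeal)).restrict _ _ hle)
        (Ideal.Quotient.mk m.asIdeal) (by ext; rfl)
    refine (hQ s).of_le ?_
    rintro _ ⟨a, rfl⟩
    refine ⟨hint a, ?_⟩
    rw [← map_inv]
    exact hint a⁻¹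
  -- Primes of the Artinian ring `E` are maximal, so an element trivial in all residue fields is
  -- unipotent.
  · refine hσ a ((nilpotent_iff_mem_prime).2 fun P hP => ?_)
    have hmax : P.IsMaximal := inferInstance
    have := congrArg Units.val (ha ⟨P, hmax⟩)
    rw [← Ideal.Quotient.eq_zero_iff_mem, map_sub, map_one, sub_eq_zero]
    exact this

theorem Matrix.isIntegral_of_forall_mem {k : Type*} [Field k] {n : Type*} [Fintype n]
    [DecidableEq n] (R : Subring k) (M : Matrix n n k) (hM : ∀ i j, M i j ∈ R) :
    IsIntegral R M := by
  have h := Matrix.isIntegral (Matrix.of fun i j => (⟨M i j, hM i j⟩ : R))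
  exact h.map (Algebra.ofId R k).mapMatrix

theorem group_fg_of_unipotentFree_matrix.{u, v} {k : Type u} [Field k]
    (hk : FiniteExtensionsHaveFGIntegralUnits k) {n : Type} [Fintype n] [DecidableEq n]
    {A : Type v} [CommGroup A] (ρ : A →* Matrix n n k)
    (hρ : ∀ a, IsNilpotent (ρ a - 1) → a = 1) (e : Finset k)
    (he : ∀ a i j, ρ a i j ∈ Subring.closure (e : Set k)) : Group.FG A := by
  let E := Algebra.adjoin k (Set.range ρ)
  have : IsMulCommutative E := Algebra.isMulCommutative_adjoin k (by
    rintro _ ⟨a, rfl⟩ _ ⟨b, rfl⟩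
    rw [← map_mul, mul_comm, map_mul])
  let : CommRing E := { (inferInstance : Ring E) with mul_comm := this.is_comm.comm }
  have : Module.Finite k E := inferInstance
  let σ : A →* E := ρ.codRestrict E fun a => Algebra.subset_adjoin ⟨a, rfl⟩
  refine group_fg_of_isIntegral_of_unipotentFree hk σ (fun a ha => hρ a ?_) e fun a => ?_
  · exact ha.map E.val
  · have := Matrix.isIntegral_of_forall_mem (Subring.closure (e : Set k)) (ρ a) (he a)
    exact (isIntegral_algHom_iff (E.val.restrictScalars (Subring.closure (e : Set k)))
      Subtype.val_injective).1 this

end Abelian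

/-! ### Descent to a suitable subfield and conclusion. -/

section Main

theorem Group.FG.of_finiteIndex {G : Type*} [Group G] (H : Subgroup G) [H.FiniteIndex]
    (hH : Group.FG H) : Group.FG G := by
  obtain ⟨T, hT⟩ := (Group.fg_iff_subgroup_fg H).1 hH
  refine Group.fg_iff.2 ⟨T ∪ Set.range (fun q : G ⧸ H => q.out), ?_,
    T.finite_toSet.union (Set.finite_range _)⟩
  refine eq_top_iff.2 fun g _ => ?_
  have hle : H ≤ Subgroup.closure ((T : Set G) ∪ Set.range (fun q : G ⧸ H => q.out)) := by
    rw [← hT]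
    exact Subgroup.closure_mono Set.subset_union_left
  have h1 : (g : G ⧸ H).out⁻¹ * g ∈ H := QuotientGroup.eq.1 (QuotientGroup.out_eq' _)
  rw [← mul_inv_cancel_left (g : G ⧸ H).out g]
  exact mul_mem (Subgroup.subset_closure (Or.inr ⟨_, rfl⟩)) (hle h1)

variable {F : Type*} [Field F] {d : ℕ}

theorem exists_finset_entries_mem_closure (G : Subgroup (GL (Fin d) F)) (hG : Group.FG G) :
    ∃ e : Finset F, ∀ g ∈ G, ∀ i j, (g : Matrix (Fin d) (Fin d) F) i j ∈
      Subring.closure (e : Set F) := by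
  classical
  obtain ⟨T, hT⟩ := (Group.fg_iff_subgroup_fg G).1 hG
  let e : Finset F := T.biUnion fun g => Finset.univ.image (fun ij : Fin d × Fin d =>
    (g : Matrix (Fin d) (Fin d) F) ij.1 ij.2) ∪ Finset.univ.image (fun ij : Fin d × Fin d =>
    ((g⁻¹ : GL (Fin d) F) : Matrix (Fin d) (Fin d) F) ij.1 ij.2)
  set R := Subring.closure (e : Set F)
  have hR : ∀ g ∈ T, ∀ i j, (g : Matrix (Fin d) (Fin d) F) i j ∈ R ∧
      ((g⁻¹ : GL (Fin d) F) : Matrix (Fin d) (Fin d) F) i j ∈ R := fun g hg i j =>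
    ⟨Subring.subset_closure (Finset.mem_coe.2 (Finset.mem_biUnion.2 ⟨g, hg,
      Finset.mem_union_left _ (Finset.mem_image_of_mem _ (Finset.mem_univ (i, j)))⟩)),
    Subring.subset_closure (Finset.mem_coe.2 (Finset.mem_biUnion.2 ⟨g, hg,
      Finset.mem_union_right _ (Finset.mem_image_of_mem _ (Finset.mem_univ (i, j)))⟩))⟩
  -- Carrying the inverse along makes the inversion case symmetric.
  have key : ∀ g ∈ G, ∀ i j, (g : Matrix (Fin d) (Fin d) F) i j ∈ R ∧
      ((g⁻¹ : GL (Fin d) F) : Matrix (Fin d) (Fin d) F) i j ∈ R := by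
    intro g hg
    rw [← hT] at hg
    induction hg using Subgroup.closure_induction with
    | mem g hg => exact hR g hg
    | one =>
      intro i j
      rw [inv_one, Units.val_one, Matrix.one_apply]
      split_ifs
      exacts [⟨one_mem _, one_mem _⟩, ⟨zero_mem _, zero_mem _⟩]
    | mul a b _ _ ha hb =>
      intro i j
      rw [mul_inv_rev, Units.val_mul, Units.val_mul, Matrix.mul_apply, Matrix.mul_apply]
      exact ⟨sum_mem fun l _ => mul_mem (ha i l).1 (hb l j).1,
        sum_mem fun l _ => mul_mem (hb i l).2 (ha l j).2⟩
    | inv a _ ha =>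
      intro i j
      rw [inv_inv]
      exact (ha i j).symm
  exact ⟨e, fun g hg i j => (key g hg i j).1⟩

theorem group_fg_of_comm_of_unipotentFree (G : Subgroup (GL (Fin d) F)) (hG : Group.FG G)
    {A : Type*} [CommGroup A] (f : A →* GL (Fin d) F) (hfG : ∀ a, f a ∈ G)
    (hf : ∀ a, (f a).IsUnipotent → a = 1) : Group.FG A := by
  classical
  obtain ⟨e, he⟩ := exists_finset_entries_mem_closure G hG
  obtain ⟨k, hek, hk⟩ := exists_subfield_finiteExtensionsHaveFGIntegralUnits e
  let e' : Finset k := e.subtype (· ∈ k)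
  have hcl : ∀ x ∈ Subring.closure (e : Set F), ∃ y ∈ Subring.closure (e' : Set k), (y : F) = x := by
    have : Subring.closure (e : Set F) ≤ (Subring.closure (e' : Set k)).map k.subtype :=
      Subring.closure_le.2 fun x hx => ⟨⟨x, hek hx⟩, Subring.subset_closure (by simpa [e'] using hx),
        rfl⟩
    exact fun x hx => this hx
  choose ρ hρ hρ' using fun a i j => hcl _ (he (f a) (hfG a) i j)
  have hmap : ∀ a, (Matrix.of (ρ a)).map k.subtype = (f a : Matrix (Fin d) (Fin d) F) := fun a => by
    ext i j
    exact hρ' a i j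
  have hinj : Function.Injective (k.subtype.mapMatrix : Matrix (Fin d) (Fin d) k →+* _) :=
    Matrix.map_injective k.subtype.injective
  let P : A →* Matrix (Fin d) (Fin d) k :=
    { toFun := fun a => Matrix.of (ρ a)
      map_one' := hinj (by
        rw [map_one, RingHom.mapMatrix_apply, hmap, map_one, Units.val_one])
      map_mul' := fun a b => hinj (by
        rw [map_mul]
        simp only [RingHom.mapMatrix_apply, hmap, map_mul, Units.val_mul]) }
  refine group_fg_of_unipotentFree_matrix hk P (fun a ha => hf a ?_) e' fun a i j => hρ a i j
  have := ha.map k.subtype.mapMatrix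
  rw [map_sub, map_one, RingHom.mapMatrix_apply] at this
  change IsNilpotent ((Matrix.of (ρ a)).map k.subtype - 1) at this
  rw [hmap] at this
  exact this

theorem isVirtuallyAbelian_of_unipotentFree {G : Type*} [Group G] (f : G →* GL (Fin d) F)
    (hf : ∀ g, (f g).IsUnipotent → g = 1) (hG : Group.IsSolvable G) : IsVirtuallyAbelian G := by
  let K := AlgebraicClosure F
  let Φ : Matrix (Fin d) (Fin d) F →+* Module.End K (Fin d → K) :=
    (Matrix.toLinAlgEquiv' : Matrix (Fin d) (Fin d) K ≃ₐ[K] _).toRingEquiv.toRingHom.comp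
      (algebraMap F K).mapMatrix
  have hΦ : Function.Injective Φ :=
    (Matrix.toLinAlgEquiv' : Matrix (Fin d) (Fin d) K ≃ₐ[K] _).injective.comp
      (Matrix.map_injective (algebraMap F K).injective)
  let ρ : G →* Module.End K (Fin d → K) := (Φ : _ →* _).comp ((Units.coeHom _).comp f)
  have hρ : IsUnipotentFree ρ := fun g hg => hf g <| by
    have : Φ ((f g : Matrix (Fin d) (Fin d) F) - 1) = ρ g - 1 := by rw [map_sub, map_one]; rfl
    rw [← this, IsNilpotent.map_iff hΦ] at hg
    exact hg
  exact hρ.isVirtuallyAbelian hG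

end Main

theorem mainTheorem4 {F : Type*} [Field F] (d : ℕ) (S : Subgroup (GL (Fin d) F))
    (hSolv : Group.IsSolvable S) (hVUF : IsVUFLinear S) :
    IsVirtuallyAbelian S ∧
      ∀ G : Subgroup (GL (Fin d) F), Group.FG G → S ≤ G → Group.FG S := by
  obtain ⟨H, hH, hHU⟩ := hVUF
  have hVA : IsVirtuallyAbelian H := isVirtuallyAbelian_of_unipotentFree (S.subtype.comp H.subtype)
    (fun g hg => Subtype.ext (hHU g g.2 hg)) inferInstance
  refine ⟨.of_finiteIndex H hVA, fun G hG hSG => ?_⟩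
  obtain ⟨A, hA, hcomm⟩ := hVA
  let : CommGroup A :=
    { (inferInstance : Group A) with
      mul_comm := fun a b => Subtype.ext (hcomm a a.2 b b.2) }
  have hAfg : Group.FG A := group_fg_of_comm_of_unipotentFree G hG
    ((S.subtype.comp H.subtype).comp A.subtype) (fun a => hSG a.1.1.2)
    (fun a ha => Subtype.ext (Subtype.ext (hHU a.1 a.1.2 ha)))
  have hHfg : Group.FG H := Group.FG.of_finiteIndex A hAfg
  exact Group.FG.of_finiteIndex H hHfg
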